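/- Let $n\ge 4$ be an integer and, for $\rho\in[0,1]$, put $$\Phi(\rho):=\int_{-1}^{1}\frac{\left|t-\frac{n-2}{n}\rho\right|\,(1-t^2)^{\frac{n-3}{2}}}{(1-2t\rho+\rho^2)^{\frac{n-2}{2}}}\,dt .$$ Then the integral converges for every $\rho\in[0,1]$, the function $\Phi$ is strictly decreasing on $[0,1]$, and $$\max_{\rho\in[0,1]}\Phi(\rho)=\Phi(0)=\frac{2}{n-1}.$$ -/

import Mathlib

/-- The integrand of `schwarzPhi`; all powers are real powers. For `ρ ∈ [0, 1]` and `t ∈ [-1, 1]`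
both bases are nonnegative, and the denominator vanishes only at `ρ = t = 1`. -/
noncomputable def schwarzIntegrand (n : ℕ) (ρ t : ℝ) : ℝ :=
  |t - ((n : ℝ) - 2) / (n : ℝ) * ρ| * (1 - t ^ 2) ^ (((n : ℝ) - 3) / 2) /
    (1 - 2 * t * ρ + ρ ^ 2) ^ (((n : ℝ) - 2) / 2)

/-- The function `Φ(ρ)`. -/
noncomputable def schwarzPhi (n : ℕ) (ρ : ℝ) : ℝ :=
  ∫ t in (-1 : ℝ)..1, schwarzIntegrand n ρ t

/-! Put `n = 2 L + 2`, `c = L / (L + 1)` and `D = 1 - 2 t ρ + ρ ^ 2`. Since `D ≥ 1 - t ^ 2`, the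
integrand is at most `2 (1 - t ^ 2) ^ (-1/2)` for every `ρ` in `[0, 1]`. This gives convergence, and
continuity of `Φ` up to `ρ = 1`.

For `0 < ρ < 1`, `Φ'(ρ)` is the integral of `sign (t - c ρ)` times `derivKernel`. That kernel has a
primitive `F` vanishing at both `t = -1` and `t = 1`, so `Φ'(ρ) = -2 F(c ρ)`, and everything rests
on `F(c ρ) > 0` (`derivKernelPrimitive_kink_pos`).

`F` combines an elementary term with `radialPrimitive` at `x = (1 - t ^ 2) / D`; the identity `1 - ρ
^ 2 x = (1 - ρ t) ^ 2 / D` makes the substitution work. The coefficient `L + 1/2 - (L - 1/2) ρ ^ 2`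
is forced by matching quadratics in `t`. A Padé bound (`radialPrimitive_le_radialMajorant`) replaces
the non-elementary integral by an upper bound whose powers cancel against the elementary term at the
kink. What is left is a polynomial inequality in `L` and `ρ ^ 2` (`weighted_padeFactor_lt`). -/

open Set MeasureTheory Filter Topology

/-! ### Padé bound for the incomplete beta integral -/

/-- The function whose primitive governs the substitution `x = (1 - t ^ 2) / (1 - 2 t ρ + ρ ^ 2)`,
with `R = ρ ^ 2`. -/
noncomputable def radialDensity (m R x : ℝ) : ℝ := x ^ (m - 1) * (1 - R * x) ^ (-(1 / 2) : ℝ)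

/-- The primitive of `radialDensity` vanishing at the origin. -/
noncomputable def radialPrimitive (m R x : ℝ) : ℝ := ∫ y in (0 : ℝ)..x, radialDensity m R y

/-- The rational factor of the Padé-type majorant of `radialPrimitive`. -/
noncomputable def padeFactor (m q : ℝ) : ℝ :=
  1 - q / (2 * (m + 1)) / (1 - (2 * m + 1) / (2 * (m + 2)) * q)

/-- A Padé-type majorant of `radialPrimitive`. -/
noncomputable def radialMajorant (m R x : ℝ) : ℝ :=
  x ^ m * (1 - R * x) ^ (-(1 / 2) : ℝ) * padeFactor m (R * x) / m

lemma pade_denominator_pos {m q : ℝ} (hm : 1 < m) (hq : q < 1) :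
    0 < 1 - (2 * m + 1) / (2 * (m + 2)) * q := by
  have : 1 - (2 * m + 1) / (2 * (m + 2)) * q
      = (3 + (2 * m + 1) * (1 - q)) / (2 * (m + 2)) := by
    have : m + 2 ≠ 0 := by positivity
    field_simp
    ring
  rw [this]
  have : 0 < 1 - q := by linarith
  positivity

/-- The differential inequality satisfied by `padeFactor`. -/
lemma padeFactor_inequality {m q : ℝ} (hm : 1 < m) (hq0 : 0 ≤ q) (hq : q < 1) :
    m ≤ m * padeFactor m q
      - q * ((1 / (2 * (m + 1))) / (1 - (2 * m + 1) / (2 * (m + 2)) * q) ^ 2)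
      + q * padeFactor m q / (2 * (1 - q)) := by
  have hN := pade_denominator_pos hm hq
  unfold padeFactor
  set N := 1 - (2 * m + 1) / (2 * (m + 2)) * q with hNdef
  have h1 : 0 < 1 - q := by linarith
  have h2 : m + 1 ≠ 0 := by positivity
  have h3 : m + 2 ≠ 0 := by positivity
  -- The Padé coefficients cancel the terms of order up to `q ^ 2`; the remaining cubic defect has a
  -- positive coefficient.
  have key : m * (1 - q / (2 * (m + 1)) / N) - q * ((1 / (2 * (m + 1))) / N ^ 2)
      + q * (1 - q / (2 * (m + 1)) / N) / (2 * (1 - q)) - m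
      = q ^ 3 * ((2 * m + 1) / (2 * (m + 2)) * (3 / (2 * (m + 1) * (m + 2))))
        / (2 * (1 - q) * N ^ 2) := by
    have h4 : q = (1 - N) * (2 * (m + 2)) / (2 * m + 1) := by
      rw [hNdef]; field_simp; ring
    have h5 : 2 * m + 1 ≠ 0 := by positivity
    field_simp
    rw [hNdef]
    field_simp
    ring
  have : 0 ≤ q ^ 3 * ((2 * m + 1) / (2 * (m + 2)) * (3 / (2 * (m + 1) * (m + 2))))
        / (2 * (1 - q) * N ^ 2) := by positivity
  linarith

lemma hasDerivAt_radialMajorant {m R x : ℝ} (hm : 1 < m) (hx : 0 < x) (hRx : R * x < 1) :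
    HasDerivAt (radialMajorant m R)
      (radialDensity m R x / m * (m * padeFactor m (R * x)
        - R * x * ((1 / (2 * (m + 1))) / (1 - (2 * m + 1) / (2 * (m + 2)) * (R * x)) ^ 2)
        + R * x * padeFactor m (R * x) / (2 * (1 - R * x)))) x := by
  have hN := pade_denominator_pos hm hRx
  have h1 : 0 < 1 - R * x := by linarith
  have hq : HasDerivAt (fun y : ℝ => R * y) R x := by
    simpa using (hasDerivAt_id x).const_mul R
  have e1 : HasDerivAt (fun y : ℝ => y ^ m) (m * x ^ (m - 1)) x :=
    Real.hasDerivAt_rpow_const (Or.inl hx.ne')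
  have e2 : HasDerivAt (fun y : ℝ => (1 - R * y) ^ (-(1 / 2) : ℝ))
      ((-R) * (-(1 / 2)) * (1 - R * x) ^ (-(1 / 2) - 1 : ℝ)) x :=
    (hq.const_sub 1).rpow_const (Or.inl h1.ne')
  have e3 := ((hq.div_const (2 * (m + 1))).div
    ((hq.const_mul ((2 * m + 1) / (2 * (m + 2)))).const_sub 1) hN.ne').const_sub 1
  have e := ((e1.mul e2).mul e3).div_const m
  refine e.congr_deriv ?_
  have hxm : x ^ m = x * x ^ (m - 1) := by
    rw [Real.rpow_sub_one hx.ne']; field_simp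
  have hm1 : m + 1 ≠ 0 := by positivity
  have hm2 : m + 2 ≠ 0 := by positivity
  have hm0 : m ≠ 0 := by positivity
  simp only [Pi.mul_apply, Pi.div_apply]
  rw [hxm, Real.rpow_sub_one h1.ne']
  unfold radialDensity padeFactor
  set N := 1 - (2 * m + 1) / (2 * (m + 2)) * (R * x) with hNdef
  -- In the quotient rule for `q / N` with `N` affine in `q`, the numerator is constant.
  have hd : R / (2 * (m + 1)) * N - R * x / (2 * (m + 1)) * -((2 * m + 1) / (2 * (m + 2)) * R)
      = R / (2 * (m + 1)) := by
    rw [hNdef]; ring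
  rw [hd]
  field_simp
  ring

lemma continuousOn_radialDensity {m R : ℝ} (hm : 1 < m) {s : Set ℝ}
    (hs : ∀ x ∈ s, R * x < 1) : ContinuousOn (radialDensity m R) s := by
  unfold radialDensity
  refine ContinuousOn.mul ?_ ?_
  · exact continuousOn_id.rpow_const fun x _ => Or.inr (by linarith)
  · exact ContinuousOn.rpow_const (by fun_prop) fun x hx => Or.inl (by have := hs x hx; linarith)

lemma mul_lt_one_of_mem_Icc {R x y : ℝ} (hR : 0 ≤ R) (hx : R * x < 1) (hy : y ∈ Icc 0 x) :
    R * y < 1 := (mul_le_mul_of_nonneg_left hy.2 hR).trans_lt hx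

lemma hasDerivAt_radialPrimitive {m R x : ℝ} (hm : 1 < m) (hR : 0 ≤ R) (hx0 : 0 ≤ x)
    (hx : R * x < 1) : HasDerivAt (radialPrimitive m R) (radialDensity m R x) x := by
  have ho : IsOpen {y : ℝ | R * y < 1} := isOpen_lt (by fun_prop) (by fun_prop)
  have hc : ContinuousOn (radialDensity m R) {y : ℝ | R * y < 1} :=
    continuousOn_radialDensity hm fun y hy => hy
  refine intervalIntegral.integral_hasDerivAt_right ?_ ?_ (hc.continuousAt (ho.mem_nhds hx))
  · refine (continuousOn_radialDensity hm fun y hy => ?_).intervalIntegrable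
    rw [uIcc_of_le hx0] at hy
    exact mul_lt_one_of_mem_Icc hR hx hy
  · exact hc.stronglyMeasurableAtFilter ho x hx

/-- Both sides vanish at the origin, and `padeFactor_inequality` compares their derivatives. -/
lemma radialPrimitive_le_radialMajorant {m R x : ℝ} (hm : 1 < m) (hR : 0 ≤ R) (hx0 : 0 ≤ x)
    (hx : R * x < 1) : radialPrimitive m R x ≤ radialMajorant m R x := by
  have hmono : MonotoneOn (fun y => radialMajorant m R y - radialPrimitive m R y) (Icc 0 x) := by
    refine monotoneOn_of_hasDerivWithinAt_nonneg (convex_Icc 0 x)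
      (f' := fun y => radialDensity m R y / m * (m * padeFactor m (R * y)
        - R * y * ((1 / (2 * (m + 1))) / (1 - (2 * m + 1) / (2 * (m + 2)) * (R * y)) ^ 2)
        + R * y * padeFactor m (R * y) / (2 * (1 - R * y))) - radialDensity m R y) ?_ ?_ ?_
    · refine ContinuousOn.sub ?_ fun y hy =>
        (hasDerivAt_radialPrimitive hm hR hy.1
          (mul_lt_one_of_mem_Icc hR hx hy)).continuousAt.continuousWithinAt
      unfold radialMajorant padeFactor
      refine ContinuousOn.div_const (ContinuousOn.mul (ContinuousOn.mul ?_ ?_) ?_) _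
      · exact continuousOn_id.rpow_const fun y _ => Or.inr (by linarith)
      · exact ContinuousOn.rpow_const (by fun_prop) fun y hy =>
          Or.inl (by have := mul_lt_one_of_mem_Icc hR hx hy; linarith)
      · exact continuousOn_const.sub (ContinuousOn.div (by fun_prop) (by fun_prop) fun y hy =>
          (pade_denominator_pos hm (mul_lt_one_of_mem_Icc hR hx hy)).ne')
    · intro y hy
      rw [interior_Icc] at hy
      have hy1 := mul_lt_one_of_mem_Icc hR hx (Ioo_subset_Icc_self hy)
      exact ((hasDerivAt_radialMajorant hm hy.1 hy1).sub
        (hasDerivAt_radialPrimitive hm hR hy.1.le hy1)).hasDerivWithinAt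
    · intro y hy
      rw [interior_Icc] at hy
      have hy1 := mul_lt_one_of_mem_Icc hR hx (Ioo_subset_Icc_self hy)
      have hineq := padeFactor_inequality hm (mul_nonneg hR hy.1.le) hy1
      have hf : 0 ≤ radialDensity m R y / m := by
        have : 0 < 1 - R * y := by linarith
        have := hy.1
        unfold radialDensity
        positivity
      have hmul := mul_le_mul_of_nonneg_left hineq hf
      rw [div_mul_cancel₀ _ (by positivity)] at hmul
      simpa using hmul
  have h := hmono (left_mem_Icc.2 hx0) (right_mem_Icc.2 hx0) hx0
  have h0 : radialMajorant m R 0 = 0 := by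
    simp [radialMajorant, Real.zero_rpow (by positivity : m ≠ 0)]
  have h1 : radialPrimitive m R 0 = 0 := by simp [radialPrimitive]
  simp only [h0, h1, sub_zero] at h
  linarith

/-! ### Polynomial inequality at the kink -/

/-- The polynomial inequality behind the monotonicity. -/
lemma weighted_padeFactor_lt {L R : ℝ} (hL : 1 ≤ L) (hR0 : 0 < R) (hR : R < 1) :
    (L + 1 / 2 - (L - 1 / 2) * R)
      * padeFactor (L + 1 / 2)
        (R * ((1 - (L / (L + 1)) ^ 2 * R) / (1 - 2 * (L / (L + 1)) * R + R)))
      < (L + 1 / 2) * (1 - L / (L + 1) * R) := by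
  obtain ⟨p, hp, rfl⟩ : ∃ p, 0 ≤ p ∧ L = p + 1 := ⟨L - 1, by linarith, by ring⟩
  have hS : 0 < 1 - R := by linarith
  have hL1 : (0 : ℝ) < p + 1 + 1 := by linarith
  have hcR : 0 < p + 1 + 1 - (p + 1) * R := by nlinarith
  have hT : 0 < (p + 1 + 1) ^ 2 - (p + 1) ^ 2 * R := by nlinarith
  -- Up to a positive factor, `M` is the denominator inside `padeFactor`, arranged as a sum of
  -- positive terms.
  set M := (p + 1 + 1 - (p + 1) * R) ^ 2 * (2 * (p + 1) + 5)
    + 3 * R * ((p + 1 + 1) ^ 2 - (p + 1) ^ 2 * R) with hM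
  have hMpos : 0 < M := by positivity
  have hDeq : (p + 1 + 1) ^ 2 - 2 * (p + 1) * (p + 1 + 1) * R + (p + 1 + 1) ^ 2 * R
      = (p + 1 + 1 - (p + 1) * R) ^ 2 + R * ((p + 1 + 1) ^ 2 - (p + 1) ^ 2 * R) := by ring
  have hD : 0 < (p + 1 + 1) ^ 2 - 2 * (p + 1) * (p + 1 + 1) * R + (p + 1 + 1) ^ 2 * R := by
    rw [hDeq]; positivity
  have hq : R * ((1 - ((p + 1) / (p + 1 + 1)) ^ 2 * R)
        / (1 - 2 * ((p + 1) / (p + 1 + 1)) * R + R))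
      = R * ((p + 1 + 1) ^ 2 - (p + 1) ^ 2 * R)
        / ((p + 1 + 1) ^ 2 - 2 * (p + 1) * (p + 1 + 1) * R + (p + 1 + 1) ^ 2 * R) := by
    rw [← mul_div_assoc, ← mul_div_mul_right _ _ (pow_pos hL1 2).ne']
    congr 1 <;> field_simp
  have hpade : padeFactor (p + 1 + 1 / 2)
      (R * ((p + 1 + 1) ^ 2 - (p + 1) ^ 2 * R)
        / ((p + 1 + 1) ^ 2 - 2 * (p + 1) * (p + 1 + 1) * R + (p + 1 + 1) ^ 2 * R))
      = 1 - (2 * (p + 1) + 5) * R * ((p + 1 + 1) ^ 2 - (p + 1) ^ 2 * R)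
          / ((2 * (p + 1) + 3) * M) := by
    have hN : 1 - (2 * (p + 1 + 1 / 2) + 1) / (2 * (p + 1 + 1 / 2 + 2))
        * (R * ((p + 1 + 1) ^ 2 - (p + 1) ^ 2 * R)
          / ((p + 1 + 1) ^ 2 - 2 * (p + 1) * (p + 1 + 1) * R + (p + 1 + 1) ^ 2 * R))
        = M / ((2 * (p + 1) + 5)
          * ((p + 1 + 1) ^ 2 - 2 * (p + 1) * (p + 1 + 1) * R + (p + 1 + 1) ^ 2 * R)) := by
      rw [eq_div_iff (by positivity), hM]
      generalize hDD : (p + 1 + 1) ^ 2 - 2 * (p + 1) * (p + 1 + 1) * R + (p + 1 + 1) ^ 2 * R = D at *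
      have : p + 1 + 1 / 2 + 2 ≠ 0 := by positivity
      field_simp
      rw [← hDD]
      ring
    unfold padeFactor
    rw [hN]
    generalize (p + 1 + 1) ^ 2 - 2 * (p + 1) * (p + 1 + 1) * R + (p + 1 + 1) ^ 2 * R = D at *
    have : p + 1 + 1 / 2 + 1 ≠ 0 := by positivity
    field_simp
    ring
  rw [hq, hpade]
  have key : M * (2 * (p + 1) + 3) < 2 * (p + 1 + 1)
      * (p + 1 + 1 / 2 - (p + 1 - 1 / 2) * R)
      * ((2 * (p + 1) + 5) * ((p + 1 + 1) ^ 2 - (p + 1) ^ 2 * R)) := by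
    -- In the basis `(1 - R) ^ 2`, `R (1 - R)`, `R ^ 2`, all coefficients are polynomials in `p = L
    -- - 1` with positive coefficients.
    have e : 2 * (p + 1 + 1) * (p + 1 + 1 / 2 - (p + 1 - 1 / 2) * R)
      * ((2 * (p + 1) + 5) * ((p + 1 + 1) ^ 2 - (p + 1) ^ 2 * R)) - M * (2 * (p + 1) + 3)
      = (28 + 176 * p + 251 * p ^ 2 + 149 * p ^ 3 + 40 * p ^ 4 + 4 * p ^ 5) * (1 - R) ^ 2
        + (38 + 217 * p + 235 * p ^ 2 + 92 * p ^ 3 + 12 * p ^ 4) * (R * (1 - R))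
        + (4 + 50 * p + 40 * p ^ 2 + 8 * p ^ 3) * R ^ 2 := by
      rw [hM]; ring
    have : 0 < (28 + 176 * p + 251 * p ^ 2 + 149 * p ^ 3 + 40 * p ^ 4 + 4 * p ^ 5) * (1 - R) ^ 2
        + (38 + 217 * p + 235 * p ^ 2 + 92 * p ^ 3 + 12 * p ^ 4) * (R * (1 - R))
        + (4 + 50 * p + 40 * p ^ 2 + 8 * p ^ 3) * R ^ 2 := by positivity
    linarith
  have e : (p + 1 + 1 / 2) * (1 - (p + 1) / (p + 1 + 1) * R)
      - (p + 1 + 1 / 2 - (p + 1 - 1 / 2) * R)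
        * (1 - (2 * (p + 1) + 5) * R * ((p + 1 + 1) ^ 2 - (p + 1) ^ 2 * R)
          / ((2 * (p + 1) + 3) * M))
      = R * (2 * (p + 1 + 1) * (p + 1 + 1 / 2 - (p + 1 - 1 / 2) * R)
          * ((2 * (p + 1) + 5) * ((p + 1 + 1) ^ 2 - (p + 1) ^ 2 * R)) - M * (2 * (p + 1) + 3))
        / (2 * (p + 1 + 1) * (2 * (p + 1) + 3) * M) := by
    clear_value M
    field_simp
    ring
  have : 0 < R * (2 * (p + 1 + 1) * (p + 1 + 1 / 2 - (p + 1 - 1 / 2) * R)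
          * ((2 * (p + 1) + 5) * ((p + 1 + 1) ^ 2 - (p + 1) ^ 2 * R)) - M * (2 * (p + 1) + 3))
        / (2 * (p + 1 + 1) * (2 * (p + 1) + 3) * M) := by
    have := sub_pos.2 key
    positivity
  linarith

/-! ### Primitive of the derivative kernel -/

/-- Up to the sign of `t - L / (L + 1) * ρ`, the `ρ`-derivative of the integrand of the
generalized `schwarzPhi`, where `n = 2 L + 2`. -/
noncomputable def derivKernel (L ρ t : ℝ) : ℝ :=
  (1 - t ^ 2) ^ (L - 1 / 2) * (1 - 2 * t * ρ + ρ ^ 2) ^ (-L - 1)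
    * (2 * L * (t - L / (L + 1) * ρ) * (t - ρ) - L / (L + 1) * (1 - 2 * t * ρ + ρ ^ 2))

/-- A primitive of `derivKernel` vanishing at `-1` and at `1`. -/
noncomputable def derivKernelPrimitive (L ρ t : ℝ) : ℝ :=
  L / (L + 1) / ρ * ((1 - t ^ 2) ^ (L + 1 / 2) * (1 - 2 * t * ρ + ρ ^ 2) ^ (-L)
    - (L + 1 / 2 - (L - 1 / 2) * ρ ^ 2)
      * radialPrimitive (L + 1 / 2) (ρ ^ 2) ((1 - t ^ 2) / (1 - 2 * t * ρ + ρ ^ 2)))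

lemma one_sub_sq_nonneg_of_mem {t : ℝ} (ht : t ∈ Icc (-1 : ℝ) 1) : 0 ≤ 1 - t ^ 2 := by
  nlinarith [ht.1, ht.2]

lemma one_sub_sq_pos_of_mem {t : ℝ} (ht : t ∈ Ioo (-1 : ℝ) 1) : 0 < 1 - t ^ 2 := by
  nlinarith [ht.1, ht.2]

lemma sq_one_sub_le_distance {ρ t : ℝ} (hρ : 0 ≤ ρ) (ht : t ≤ 1) :
    (1 - ρ) ^ 2 ≤ 1 - 2 * t * ρ + ρ ^ 2 := by nlinarith

lemma distance_pos {ρ t : ℝ} (hρ : 0 ≤ ρ) (hρ1 : ρ < 1) (ht : t ≤ 1) :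
    0 < 1 - 2 * t * ρ + ρ ^ 2 :=
  (pow_pos (sub_pos.2 hρ1) 2).trans_le (sq_one_sub_le_distance hρ ht)

lemma one_sub_mul_pos {ρ t : ℝ} (hρ : 0 ≤ ρ) (hρ1 : ρ < 1) (ht : t ≤ 1) : 0 < 1 - ρ * t := by
  nlinarith

/-- The perfect square in the numerator turns the half power in `radialDensity` into `D ^ (1/2) / (1
- ρ t)`. -/
lemma one_sub_sq_mul_ratio {ρ t : ℝ} (hD : 0 < 1 - 2 * t * ρ + ρ ^ 2) :
    1 - ρ ^ 2 * ((1 - t ^ 2) / (1 - 2 * t * ρ + ρ ^ 2))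
      = (1 - ρ * t) ^ 2 / (1 - 2 * t * ρ + ρ ^ 2) := by
  generalize hDD : 1 - 2 * t * ρ + ρ ^ 2 = D at *
  field_simp
  rw [← hDD]
  ring

lemma sq_mul_ratio_lt_one {ρ t : ℝ} (hρ : 0 ≤ ρ) (hρ1 : ρ < 1) (ht : t ≤ 1) :
    ρ ^ 2 * ((1 - t ^ 2) / (1 - 2 * t * ρ + ρ ^ 2)) < 1 := by
  have h := one_sub_sq_mul_ratio (distance_pos hρ hρ1 ht)
  have : 0 < (1 - ρ * t) ^ 2 / (1 - 2 * t * ρ + ρ ^ 2) :=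
    div_pos (pow_pos (one_sub_mul_pos hρ hρ1 ht) 2) (distance_pos hρ hρ1 ht)
  linarith

lemma sq_div_rpow_neg_half {x D : ℝ} (hx : 0 < x) (hD : 0 < D) :
    (x ^ 2 / D) ^ (-(1 / 2) : ℝ) = D ^ (1 / 2 : ℝ) / x := by
  rw [Real.div_rpow (by positivity) hD.le, Real.rpow_neg hD.le, ← Real.rpow_natCast,
    ← Real.rpow_mul hx.le, div_inv_eq_mul]
  norm_num
  rw [Real.rpow_neg_one]
  field_simp

lemma radialDensity_ratio {L ρ t : ℝ} (hρ : 0 ≤ ρ) (hρ1 : ρ < 1) (ht : t ∈ Icc (-1 : ℝ) 1) :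
    radialDensity (L + 1 / 2) (ρ ^ 2) ((1 - t ^ 2) / (1 - 2 * t * ρ + ρ ^ 2))
      = (1 - t ^ 2) ^ (L - 1 / 2) * (1 - 2 * t * ρ + ρ ^ 2) ^ (-L - 1)
        * (1 - 2 * t * ρ + ρ ^ 2) ^ 2 / (1 - ρ * t) := by
  have hD := distance_pos hρ hρ1 ht.2
  unfold radialDensity
  rw [one_sub_sq_mul_ratio hD, sq_div_rpow_neg_half (one_sub_mul_pos hρ hρ1 ht.2) hD,
    Real.div_rpow (one_sub_sq_nonneg_of_mem ht) hD.le, div_eq_mul_inv _ (_ ^ (L + 1 / 2 - 1)),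
    ← Real.rpow_neg hD.le]
  have : (1 - 2 * t * ρ + ρ ^ 2) ^ (-L - 1) * (1 - 2 * t * ρ + ρ ^ 2) ^ 2
      = (1 - 2 * t * ρ + ρ ^ 2) ^ (-(L + 1 / 2 - 1)) * (1 - 2 * t * ρ + ρ ^ 2) ^ (1 / 2 : ℝ) := by
    generalize 1 - 2 * t * ρ + ρ ^ 2 = D at *
    rw [← Real.rpow_natCast, ← Real.rpow_add hD, ← Real.rpow_add hD]
    congr 1
    push_cast
    ring
  rw [mul_assoc ((1 - t ^ 2) ^ (L - 1 / 2)), this, show L + 1 / 2 - 1 = L - 1 / 2 by ring]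
  ring

lemma radialMajorant_ratio {L ρ t : ℝ} (hρ : 0 ≤ ρ) (hρ1 : ρ < 1) (ht : t ∈ Icc (-1 : ℝ) 1) :
    radialMajorant (L + 1 / 2) (ρ ^ 2) ((1 - t ^ 2) / (1 - 2 * t * ρ + ρ ^ 2))
      = (1 - t ^ 2) ^ (L + 1 / 2) * (1 - 2 * t * ρ + ρ ^ 2) ^ (-L) / (1 - ρ * t)
        * padeFactor (L + 1 / 2) (ρ ^ 2 * ((1 - t ^ 2) / (1 - 2 * t * ρ + ρ ^ 2)))
        / (L + 1 / 2) := by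
  have hD := distance_pos hρ hρ1 ht.2
  unfold radialMajorant
  rw [one_sub_sq_mul_ratio hD, sq_div_rpow_neg_half (one_sub_mul_pos hρ hρ1 ht.2) hD,
    Real.div_rpow (one_sub_sq_nonneg_of_mem ht) hD.le, div_eq_mul_inv _ (_ ^ (L + 1 / 2)),
    ← Real.rpow_neg hD.le]
  have : (1 - 2 * t * ρ + ρ ^ 2) ^ (-L)
      = (1 - 2 * t * ρ + ρ ^ 2) ^ (-(L + 1 / 2)) * (1 - 2 * t * ρ + ρ ^ 2) ^ (1 / 2 : ℝ) := by
    rw [← Real.rpow_add hD]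
    congr 1
    ring
  rw [this]
  ring

lemma hasDerivAt_derivKernelPrimitive {L ρ t : ℝ} (hL : 1 ≤ L) (hρ : 0 < ρ) (hρ1 : ρ < 1)
    (ht : t ∈ Ioo (-1 : ℝ) 1) :
    HasDerivAt (derivKernelPrimitive L ρ) (derivKernel L ρ t) t := by
  have hD := distance_pos hρ.le hρ1 ht.2.le
  have hW := one_sub_sq_pos_of_mem ht
  have hx := one_sub_mul_pos hρ.le hρ1 ht.2.le
  have dW : HasDerivAt (fun s : ℝ => 1 - s ^ 2) (-(2 * t)) t := by
    simpa using (hasDerivAt_pow 2 t).const_sub 1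
  have dD : HasDerivAt (fun s : ℝ => 1 - 2 * s * ρ + ρ ^ 2) (-(2 * ρ)) t := by
    simpa using ((((hasDerivAt_id t).const_mul 2).mul_const ρ).const_sub 1).add_const (ρ ^ 2)
  have e1 := dW.rpow_const (p := L + 1 / 2) (Or.inl hW.ne')
  have e2 := dD.rpow_const (p := -L) (Or.inl hD.ne')
  have e3 := dW.div dD hD.ne'
  have e4 := HasDerivAt.comp t (hasDerivAt_radialPrimitive (m := L + 1 / 2)
    (x := (1 - t ^ 2) / (1 - 2 * t * ρ + ρ ^ 2)) (by linarith)
    (sq_nonneg ρ) (div_nonneg hW.le hD.le) (sq_mul_ratio_lt_one hρ.le hρ1 ht.2.le)) e3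
  have e := ((e1.mul e2).sub (e4.const_mul (L + 1 / 2 - (L - 1 / 2) * ρ ^ 2))).const_mul
    (L / (L + 1) / ρ)
  refine e.congr_deriv ?_
  rw [radialDensity_ratio hρ.le hρ1 (Ioo_subset_Icc_self ht)]
  have h1 : (1 - t ^ 2) ^ (L + 1 / 2) = (1 - t ^ 2) ^ (L - 1 / 2) * (1 - t ^ 2) := by
    rw [← Real.rpow_add_one hW.ne']; congr 1; ring
  have h2 : (1 - 2 * t * ρ + ρ ^ 2) ^ (-L)
      = (1 - 2 * t * ρ + ρ ^ 2) ^ (-L - 1) * (1 - 2 * t * ρ + ρ ^ 2) := by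
    rw [← Real.rpow_add_one hD.ne']; congr 1; ring
  unfold derivKernel
  rw [h1, h2, show L + 1 / 2 - 1 = L - 1 / 2 by ring]
  generalize (1 - t ^ 2) ^ (L - 1 / 2) = w
  generalize (1 - 2 * t * ρ + ρ ^ 2) ^ (-L - 1) = d
  have hne : L + 1 ≠ 0 := by positivity
  -- The factor `1 - ρ t` of the derivative of `x` cancels the denominator from
  -- `radialDensity_ratio`.
  have hu : -(2 * t) * (1 - 2 * t * ρ + ρ ^ 2) - (1 - t ^ 2) * -(2 * ρ)
      = 2 * (ρ - t) * (1 - ρ * t) := by ring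
  rw [hu]
  generalize hDD : 1 - 2 * t * ρ + ρ ^ 2 = D at *
  field_simp
  rw [← hDD]
  ring

lemma continuousOn_derivKernel {L ρ : ℝ} (hL : 1 ≤ L) (hρ : 0 ≤ ρ) (hρ1 : ρ < 1) :
    ContinuousOn (derivKernel L ρ) (Icc (-1) 1) := by
  unfold derivKernel
  refine ContinuousOn.mul (ContinuousOn.mul ?_ ?_) (by fun_prop)
  · exact ContinuousOn.rpow_const (by fun_prop) fun t _ => Or.inr (by linarith)
  · exact ContinuousOn.rpow_const (by fun_prop) fun t ht =>
      Or.inl (distance_pos hρ hρ1 ht.2).ne'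

lemma continuousOn_derivKernelPrimitive {L ρ : ℝ} (hL : 1 ≤ L) (hρ : 0 ≤ ρ) (hρ1 : ρ < 1) :
    ContinuousOn (derivKernelPrimitive L ρ) (Icc (-1) 1) := by
  unfold derivKernelPrimitive
  refine continuousOn_const.mul (ContinuousOn.sub (ContinuousOn.mul ?_ ?_)
    (continuousOn_const.mul fun t ht => ?_))
  · exact ContinuousOn.rpow_const (by fun_prop) fun t _ => Or.inr (by linarith)
  · exact ContinuousOn.rpow_const (by fun_prop) fun t ht =>
      Or.inl (distance_pos hρ hρ1 ht.2).ne'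
  · have hD := distance_pos hρ hρ1 ht.2
    have h1 := (hasDerivAt_radialPrimitive (m := L + 1 / 2) (by linarith) (sq_nonneg ρ)
      (div_nonneg (one_sub_sq_nonneg_of_mem ht) hD.le)
      (sq_mul_ratio_lt_one hρ hρ1 ht.2)).continuousAt
    have h2 : ContinuousAt (fun s : ℝ => (1 - s ^ 2) / (1 - 2 * s * ρ + ρ ^ 2)) t :=
      ContinuousAt.div (by fun_prop) (by fun_prop) hD.ne'
    exact (ContinuousAt.comp (f := fun s : ℝ => (1 - s ^ 2) / (1 - 2 * s * ρ + ρ ^ 2))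
      h1 h2).continuousWithinAt

lemma derivKernelPrimitive_eq_zero {L ρ t : ℝ} (hL : 1 ≤ L) (ht : t ^ 2 = 1) :
    derivKernelPrimitive L ρ t = 0 := by
  simp [derivKernelPrimitive, radialPrimitive, ht,
    Real.zero_rpow (by positivity : L + 2⁻¹ ≠ 0)]

lemma kink_mem_Ioo {L ρ : ℝ} (hL : 1 ≤ L) (hρ : 0 < ρ) (hρ1 : ρ < 1) :
    L / (L + 1) * ρ ∈ Ioo (0 : ℝ) 1 := by
  have h : L / (L + 1) < 1 := (div_lt_one (by linarith)).2 (by linarith)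
  refine ⟨by positivity, ?_⟩
  nlinarith

/-- After the Padé bound, both terms of the primitive carry the positive factor `(1 - a ^ 2) ^ (L +
1/2) * D ^ (-L)`, where `a` is the kink; dividing it out leaves `weighted_padeFactor_lt` with `R = ρ
^ 2`. -/
lemma derivKernelPrimitive_kink_pos {L ρ : ℝ} (hL : 1 ≤ L) (hρ : 0 < ρ) (hρ1 : ρ < 1) :
    0 < derivKernelPrimitive L ρ (L / (L + 1) * ρ) := by
  obtain ⟨ha0, ha1⟩ := kink_mem_Ioo hL hρ hρ1
  have hR : ρ ^ 2 < 1 := by nlinarith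
  have hR0 : 0 < ρ ^ 2 := by positivity
  have key := weighted_padeFactor_lt hL hR0 hR
  have e1 : 1 - (L / (L + 1)) ^ 2 * ρ ^ 2 = 1 - (L / (L + 1) * ρ) ^ 2 := by ring
  have e2 : 1 - 2 * (L / (L + 1)) * ρ ^ 2 + ρ ^ 2
      = 1 - 2 * (L / (L + 1) * ρ) * ρ + ρ ^ 2 := by ring
  have e3 : 1 - L / (L + 1) * ρ ^ 2 = 1 - ρ * (L / (L + 1) * ρ) := by ring
  rw [e1, e2, e3] at key
  have hc : 0 < L / (L + 1) := by positivity
  unfold derivKernelPrimitive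
  generalize L / (L + 1) * ρ = a at *
  have ham : a ∈ Icc (-1 : ℝ) 1 := ⟨by linarith, ha1.le⟩
  have hD := distance_pos hρ.le hρ1 ha1.le
  have hW := one_sub_sq_pos_of_mem (t := a) ⟨by linarith, ha1⟩
  have hx := one_sub_mul_pos hρ.le hρ1 ha1.le
  have hJ := radialPrimitive_le_radialMajorant (m := L + 1 / 2) (by linarith) (sq_nonneg ρ)
    (div_nonneg hW.le hD.le) (sq_mul_ratio_lt_one hρ.le hρ1 ha1.le)
  rw [radialMajorant_ratio hρ.le hρ1 ham] at hJ
  have hB : 0 < (1 - a ^ 2) ^ (L + 1 / 2) * (1 - 2 * a * ρ + ρ ^ 2) ^ (-L) := by positivity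
  generalize (1 - a ^ 2) ^ (L + 1 / 2) * (1 - 2 * a * ρ + ρ ^ 2) ^ (-L) = B at *
  generalize padeFactor (L + 1 / 2) (ρ ^ 2 * ((1 - a ^ 2) / (1 - 2 * a * ρ + ρ ^ 2))) = g at *
  refine mul_pos (div_pos hc hρ) (sub_pos.2 ?_)
  have hK : 0 < L + 1 / 2 - (L - 1 / 2) * ρ ^ 2 := by nlinarith
  refine (mul_le_mul_of_nonneg_left hJ hK.le).trans_lt ?_
  have e : (L + 1 / 2 - (L - 1 / 2) * ρ ^ 2) * (B / (1 - ρ * a) * g / (L + 1 / 2))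
      = B * (((L + 1 / 2 - (L - 1 / 2) * ρ ^ 2) * g) / ((L + 1 / 2) * (1 - ρ * a))) := by
    field_simp
  rw [e]
  have hlt := (div_lt_one (by positivity : 0 < (L + 1 / 2) * (1 - ρ * a))).2 key
  exact (mul_lt_mul_of_pos_left hlt hB).trans_eq (mul_one B)

lemma integral_derivKernel {L ρ s t : ℝ} (hL : 1 ≤ L) (hρ : 0 < ρ) (hρ1 : ρ < 1)
    (hs : -1 ≤ s) (hst : s ≤ t) (ht : t ≤ 1) :
    ∫ y in s..t, derivKernel L ρ y = derivKernelPrimitive L ρ t - derivKernelPrimitive L ρ s := by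
  have hsub : Icc s t ⊆ Icc (-1) 1 := Icc_subset_Icc hs ht
  refine intervalIntegral.integral_eq_sub_of_hasDerivAt_of_le hst
    ((continuousOn_derivKernelPrimitive hL hρ.le hρ1).mono hsub) (fun y hy =>
      hasDerivAt_derivKernelPrimitive hL hρ hρ1 ⟨hs.trans_lt hy.1, hy.2.trans_le ht⟩) ?_
  refine ((continuousOn_derivKernel hL hρ.le hρ1).mono ?_).intervalIntegrable
  rwa [uIcc_of_le hst]

lemma integral_sign_mul_derivKernel {L ρ : ℝ} (hL : 1 ≤ L) (hρ : 0 < ρ) (hρ1 : ρ < 1) :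
    ∫ t in (-1 : ℝ)..1, (SignType.sign (t - L / (L + 1) * ρ) : ℝ) * derivKernel L ρ t
      = -2 * derivKernelPrimitive L ρ (L / (L + 1) * ρ) := by
  obtain ⟨ha0, ha1⟩ := kink_mem_Ioo hL hρ hρ1
  generalize L / (L + 1) * ρ = a at *
  have hk : ContinuousOn (derivKernel L ρ) (Icc (-1) 1) := continuousOn_derivKernel hL hρ.le hρ1
  have hint (s t : ℝ) (hs : -1 ≤ s) (hst : s ≤ t) (ht : t ≤ 1) :
      IntervalIntegrable (derivKernel L ρ) volume s t :=
    (hk.mono (by rw [uIcc_of_le hst]; exact Icc_subset_Icc hs ht)).intervalIntegrable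
  have hl : EqOn (fun t => -derivKernel L ρ t)
      (fun t => (SignType.sign (t - a) : ℝ) * derivKernel L ρ t) (Ioo (-1) a) := fun t ht => by
    have : t - a < 0 := sub_neg.2 ht.2
    simp [sign_neg this]
  have hr : EqOn (fun t => derivKernel L ρ t)
      (fun t => (SignType.sign (t - a) : ℝ) * derivKernel L ρ t) (Ioo a 1) := fun t ht => by
    have : 0 < t - a := sub_pos.2 ht.1
    simp [sign_pos this]
  have il := (hint (-1) a le_rfl (by linarith) ha1.le).neg
  have ir := hint a 1 (by linarith) ha1.le le_rfl
  rw [← intervalIntegral.integral_add_adjacent_intervals (b := a)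
    (il.congr_uIoo (by rw [uIoo_of_le (by linarith)]; exact hl))
    (ir.congr_uIoo (by rw [uIoo_of_le ha1.le]; exact hr)),
    ← intervalIntegral.integral_congr_Ioo_of_le (by linarith) hl,
    ← intervalIntegral.integral_congr_Ioo_of_le ha1.le hr,
    intervalIntegral.integral_neg, integral_derivKernel hL hρ hρ1 le_rfl (by linarith) ha1.le,
    integral_derivKernel hL hρ hρ1 (by linarith) ha1.le le_rfl,
    derivKernelPrimitive_eq_zero (t := 1) hL (by norm_num),
    derivKernelPrimitive_eq_zero (t := -1) hL (by norm_num)]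
  ring

/-! ### Integrability and continuity up to `ρ = 1` -/

/-- The integrand of `schwarzPhi` with `n = 2 L + 2`. -/
noncomputable def kinkIntegrand (L ρ t : ℝ) : ℝ :=
  |t - L / (L + 1) * ρ| * (1 - t ^ 2) ^ (L - 1 / 2) / (1 - 2 * t * ρ + ρ ^ 2) ^ L

/-- The difference is `(t - ρ) ^ 2`. Unlike `sq_one_sub_le_distance`, this bound does not degenerate
as `ρ` tends to `1`. -/
lemma one_sub_sq_le_distance (ρ t : ℝ) : 1 - t ^ 2 ≤ 1 - 2 * t * ρ + ρ ^ 2 := by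
  nlinarith [sq_nonneg (ρ - t)]

lemma measurable_kinkIntegrand (L ρ : ℝ) : Measurable (kinkIntegrand L ρ) := by
  unfold kinkIntegrand
  fun_prop

lemma ae_mem_Ioo_of_mem_uIoc {a b : ℝ} (hab : a ≤ b) :
    ∀ᵐ t ∂(volume : Measure ℝ), t ∈ uIoc a b → t ∈ Ioo a b := by
  have : ∀ᵐ t ∂(volume : Measure ℝ), t ≠ b := by simp [ae_iff]
  filter_upwards [this] with t ht h
  rw [uIoc_of_le hab] at h
  exact ⟨h.1, lt_of_le_of_ne h.2 ht⟩

/-- One of `1 - t`, `1 + t` is at least `1`, so its negative power is at most `1`. -/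
lemma one_sub_sq_rpow_neg_half_le {t : ℝ} (ht : t ∈ Ioo (-1 : ℝ) 1) :
    (1 - t ^ 2) ^ (-(1 / 2) : ℝ) ≤ (1 - t) ^ (-(1 / 2) : ℝ) + (1 + t) ^ (-(1 / 2) : ℝ) := by
  have h1 : 0 < 1 - t := by linarith [ht.2]
  have h2 : 0 < 1 + t := by linarith [ht.1]
  have p1 : 0 < (1 - t) ^ (-(1 / 2) : ℝ) := by positivity
  have p2 : 0 < (1 + t) ^ (-(1 / 2) : ℝ) := by positivity
  rw [show 1 - t ^ 2 = (1 - t) * (1 + t) by ring, Real.mul_rpow h1.le h2.le]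
  rcases le_total t 0 with h | h
  · have : (1 - t) ^ (-(1 / 2) : ℝ) ≤ 1 :=
      Real.rpow_le_one_of_one_le_of_nonpos (by linarith) (by norm_num)
    nlinarith
  · have : (1 + t) ^ (-(1 / 2) : ℝ) ≤ 1 :=
      Real.rpow_le_one_of_one_le_of_nonpos (by linarith) (by norm_num)
    nlinarith

lemma abs_sub_kink_le_two {L ρ t : ℝ} (hL : 1 ≤ L) (hρ : ρ ∈ Icc (0 : ℝ) 1)
    (ht : t ∈ Icc (-1 : ℝ) 1) : |t - L / (L + 1) * ρ| ≤ 2 := by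
  have h : L / (L + 1) ≤ 1 := (div_le_one (by linarith)).2 (by linarith)
  have h0 : 0 ≤ L / (L + 1) := by positivity
  have h1 : L / (L + 1) * ρ ≤ 1 := mul_le_one₀ h hρ.1 hρ.2
  have h2 : 0 ≤ L / (L + 1) * ρ := mul_nonneg h0 hρ.1
  rw [abs_le]
  constructor <;> linarith [ht.1, ht.2]

lemma norm_kinkIntegrand_le {L ρ t : ℝ} (hL : 1 ≤ L) (hρ : ρ ∈ Icc (0 : ℝ) 1)
    (ht : t ∈ Ioo (-1 : ℝ) 1) :
    ‖kinkIntegrand L ρ t‖ ≤ 2 * ((1 - t) ^ (-(1 / 2) : ℝ) + (1 + t) ^ (-(1 / 2) : ℝ)) := by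
  have hW := one_sub_sq_pos_of_mem ht
  have hD := hW.trans_le (one_sub_sq_le_distance ρ t)
  refine le_trans ?_ (mul_le_mul_of_nonneg_left (one_sub_sq_rpow_neg_half_le ht) zero_le_two)
  have hnn : 0 ≤ kinkIntegrand L ρ t := by unfold kinkIntegrand; positivity
  rw [Real.norm_of_nonneg hnn]
  unfold kinkIntegrand
  rw [mul_div_assoc]
  refine mul_le_mul (abs_sub_kink_le_two hL hρ (Ioo_subset_Icc_self ht)) ?_ (by positivity)
    zero_le_two
  rw [div_le_iff₀ (by positivity)]
  calc (1 - t ^ 2) ^ (L - 1 / 2) = (1 - t ^ 2) ^ (-(1 / 2) : ℝ) * (1 - t ^ 2) ^ L := by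
        rw [← Real.rpow_add hW]; congr 1; ring
    _ ≤ _ := by
        gcongr
        exact one_sub_sq_le_distance ρ t

lemma intervalIntegrable_kinkBound : IntervalIntegrable
    (fun t : ℝ => 2 * ((1 - t) ^ (-(1 / 2) : ℝ) + (1 + t) ^ (-(1 / 2) : ℝ))) volume (-1) 1 := by
  have h : IntervalIntegrable (fun x : ℝ => x ^ (-(1 / 2) : ℝ)) volume 0 2 :=
    intervalIntegral.intervalIntegrable_rpow' (by norm_num)
  have h1 := (h.comp_sub_left 1).symm
  have h2 := h.comp_add_left 1
  norm_num at h1 h2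
  norm_num
  exact (h1.add h2).const_mul 2

lemma intervalIntegrable_kinkIntegrand {L ρ : ℝ} (hL : 1 ≤ L) (hρ : ρ ∈ Icc (0 : ℝ) 1) :
    IntervalIntegrable (kinkIntegrand L ρ) volume (-1) 1 := by
  refine intervalIntegrable_kinkBound.mono_fun
    (measurable_kinkIntegrand L ρ).aestronglyMeasurable ?_
  refine (ae_restrict_iff' measurableSet_uIoc).2 ?_
  filter_upwards [ae_mem_Ioo_of_mem_uIoc (show (-1 : ℝ) ≤ 1 by norm_num)] with t ht h
  exact (norm_kinkIntegrand_le hL hρ (ht h)).trans (le_abs_self _)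

lemma continuousOn_integral_kinkIntegrand {L : ℝ} (hL : 1 ≤ L) :
    ContinuousOn (fun ρ => ∫ t in (-1 : ℝ)..1, kinkIntegrand L ρ t) (Icc 0 1) := by
  intro ρ hρ
  refine intervalIntegral.continuousWithinAt_of_dominated_interval
    (Eventually.of_forall fun r => (measurable_kinkIntegrand L r).aestronglyMeasurable) ?_
    intervalIntegrable_kinkBound ?_
  · filter_upwards [self_mem_nhdsWithin] with r hr
    filter_upwards [ae_mem_Ioo_of_mem_uIoc (show (-1 : ℝ) ≤ 1 by norm_num)] with t ht h
    exact norm_kinkIntegrand_le hL hr (ht h)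
  · filter_upwards [ae_mem_Ioo_of_mem_uIoc (show (-1 : ℝ) ≤ 1 by norm_num)] with t ht h
    have hD := (one_sub_sq_pos_of_mem (ht h)).trans_le (one_sub_sq_le_distance ρ t)
    unfold kinkIntegrand
    refine ContinuousAt.continuousWithinAt (ContinuousAt.div (by fun_prop) ?_ (by positivity))
    exact ContinuousAt.rpow_const (by fun_prop) (Or.inl hD.ne')

/-! ### Differentiation under the integral sign -/

lemma kinkIntegrand_eq_abs {L t : ℝ} (ρ : ℝ) (ht : t ∈ Ioo (-1 : ℝ) 1) :
    kinkIntegrand L ρ t = |(t - L / (L + 1) * ρ)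
      * ((1 - t ^ 2) ^ (L - 1 / 2) * (1 - 2 * t * ρ + ρ ^ 2) ^ (-L))| := by
  have hW := one_sub_sq_pos_of_mem ht
  have hD := hW.trans_le (one_sub_sq_le_distance ρ t)
  have hpos : 0 < (1 - t ^ 2) ^ (L - 1 / 2) * (1 - 2 * t * ρ + ρ ^ 2) ^ (-L) := by positivity
  rw [abs_mul, abs_of_pos hpos, Real.rpow_neg hD.le]
  unfold kinkIntegrand
  ring

lemma hasDerivAt_signed_integrand (L : ℝ) {ρ t : ℝ} (hD : 0 < 1 - 2 * t * ρ + ρ ^ 2) :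
    HasDerivAt (fun r => (t - L / (L + 1) * r)
      * ((1 - t ^ 2) ^ (L - 1 / 2) * (1 - 2 * t * r + r ^ 2) ^ (-L))) (derivKernel L ρ t) ρ := by
  have e1 : HasDerivAt (fun r => t - L / (L + 1) * r) (-(L / (L + 1))) ρ := by
    simpa using ((hasDerivAt_id ρ).const_mul (L / (L + 1))).const_sub t
  have e2 : HasDerivAt (fun r => 1 - 2 * t * r + r ^ 2) (-(2 * t) + 2 * ρ) ρ :=
    ((((hasDerivAt_id ρ).const_mul (2 * t)).const_sub 1).add (hasDerivAt_pow 2 ρ)).congr_deriv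
      (by simp)
  have e := e1.mul ((e2.rpow_const (p := -L) (Or.inl hD.ne')).const_mul
    ((1 - t ^ 2) ^ (L - 1 / 2)))
  refine e.congr_deriv ?_
  have h2 : (1 - 2 * t * ρ + ρ ^ 2) ^ (-L)
      = (1 - 2 * t * ρ + ρ ^ 2) ^ (-L - 1) * (1 - 2 * t * ρ + ρ ^ 2) := by
    rw [← Real.rpow_add_one hD.ne']; congr 1; ring
  unfold derivKernel
  rw [h2]
  ring

lemma abs_derivKernel_le {L r ρ t : ℝ} (hL : 1 ≤ L) (hr : r < 1) (hρ : 0 ≤ ρ) (hρr : ρ ≤ r)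
    (ht : t ∈ Icc (-1 : ℝ) 1) :
    |derivKernel L ρ t| ≤ ((1 - r) ^ 2) ^ (-L - 1) * (8 * L + 4) := by
  have hρ1 : ρ < 1 := hρr.trans_lt hr
  have hW := one_sub_sq_nonneg_of_mem ht
  have hD := distance_pos hρ hρ1 ht.2
  have hr0 : 0 < (1 - r) ^ 2 := pow_pos (by linarith) 2
  have hDr : (1 - r) ^ 2 ≤ 1 - 2 * t * ρ + ρ ^ 2 :=
    (by nlinarith : (1 - r) ^ 2 ≤ (1 - ρ) ^ 2).trans (sq_one_sub_le_distance hρ ht.2)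
  have hw : (1 - t ^ 2) ^ (L - 1 / 2) ≤ 1 :=
    Real.rpow_le_one hW (by nlinarith) (by linarith)
  have hd : (1 - 2 * t * ρ + ρ ^ 2) ^ (-L - 1) ≤ ((1 - r) ^ 2) ^ (-L - 1) :=
    Real.rpow_le_rpow_of_nonpos hr0 hDr (by linarith)
  have hk := abs_sub_kink_le_two hL ⟨hρ, hρ1.le⟩ ht
  have hc : L / (L + 1) ≤ 1 := (div_le_one (by linarith)).2 (by linarith)
  have hc0 : 0 ≤ L / (L + 1) := by positivity
  have hD4 : 1 - 2 * t * ρ + ρ ^ 2 ≤ 4 := by nlinarith [ht.1, ht.2]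
  have htρ : |t - ρ| ≤ 2 := by
    rw [abs_le]; constructor <;> linarith [ht.1, ht.2]
  -- Both differences are at most `2` in absolute value, and `D ≤ 4`.
  have hb : |2 * L * (t - L / (L + 1) * ρ) * (t - ρ)
      - L / (L + 1) * (1 - 2 * t * ρ + ρ ^ 2)| ≤ 8 * L + 4 := by
    refine (abs_sub _ _).trans (add_le_add ?_ ?_)
    · rw [abs_mul, abs_mul, abs_of_nonneg (by positivity : 0 ≤ 2 * L)]
      calc 2 * L * |t - L / (L + 1) * ρ| * |t - ρ| ≤ 2 * L * 2 * 2 := by gcongr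
        _ = 8 * L := by ring
    · rw [abs_of_nonneg (by positivity)]
      calc _ ≤ 1 * (4 : ℝ) := by gcongr
        _ = 4 := by ring
  unfold derivKernel
  rw [abs_mul, abs_of_nonneg (by positivity)]
  calc _ ≤ 1 * ((1 - r) ^ 2) ^ (-L - 1) * (8 * L + 4) := by gcongr
    _ = _ := by ring

/-- The absolute value breaks differentiability only at `t = c ρ`, a null set. The Lipschitz form of
the theorem applies, as the absolute value does not increase the Lipschitz constant of the signed
integrand. -/
lemma hasDerivAt_integral_kinkIntegrand {L ρ : ℝ} (hL : 1 ≤ L) (hρ : 0 < ρ) (hρ1 : ρ < 1) :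
    HasDerivAt (fun r => ∫ t in (-1 : ℝ)..1, kinkIntegrand L r t)
      (∫ t in (-1 : ℝ)..1, (SignType.sign (t - L / (L + 1) * ρ) : ℝ) * derivKernel L ρ t) ρ := by
  -- Staying below `r < 1` keeps `D ≥ (1 - r) ^ 2`, hence the kernel bounded uniformly in `t`.
  obtain ⟨r, hρr, hr⟩ := exists_between hρ1
  set C := ((1 - r) ^ 2) ^ (-L - 1) * (8 * L + 4) with hC
  have hC0 : 0 ≤ C := by positivity
  have hIoo := ae_mem_Ioo_of_mem_uIoc (show (-1 : ℝ) ≤ 1 by norm_num)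
  refine (intervalIntegral.hasDerivAt_integral_of_dominated_loc_of_lip (bound := fun _ => C)
    (Ioo_mem_nhds hρ hρr)
    (Eventually.of_forall fun x => (measurable_kinkIntegrand L x).aestronglyMeasurable)
    (intervalIntegrable_kinkIntegrand hL ⟨hρ.le, hρ1.le⟩) ?_ ?_
    intervalIntegrable_const ?_).2
  · have hm : Measurable fun t : ℝ => (SignType.sign (t - L / (L + 1) * ρ) : ℝ) := by
      have : (fun t : ℝ => (SignType.sign (t - L / (L + 1) * ρ) : ℝ))
          = fun t => if L / (L + 1) * ρ < t then 1 else if t < L / (L + 1) * ρ then -1 else 0 := by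
        ext t
        simp only [sign_apply, sub_pos, sub_neg]
        split_ifs <;> simp
      rw [this]
      exact Measurable.ite measurableSet_Ioi measurable_const
        (Measurable.ite measurableSet_Iio measurable_const measurable_const)
    have hk : Measurable (derivKernel L ρ) := by
      unfold derivKernel
      fun_prop
    exact (hm.mul hk).aestronglyMeasurable
  · filter_upwards [hIoo] with t ht h
    have hlip (x y : ℝ) (hx : x ∈ Ioo 0 r) (hy : y ∈ Ioo 0 r) := (convex_Ioo 0 r).norm_image_sub_le_of_norm_hasDerivWithin_le
      (f := fun x => (t - L / (L + 1) * x)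
        * ((1 - t ^ 2) ^ (L - 1 / 2) * (1 - 2 * t * x + x ^ 2) ^ (-L)))
      (fun x hx => (hasDerivAt_signed_integrand L
        (distance_pos hx.1.le (hx.2.trans hr) (ht h).2.le)).hasDerivWithinAt)
      (fun x hx => abs_derivKernel_le hL hr hx.1.le hx.2.le (Ioo_subset_Icc_self (ht h))) hx hy
    refine LipschitzOnWith.of_dist_le_mul fun x hx y hy => ?_
    rw [Real.dist_eq, Real.dist_eq, kinkIntegrand_eq_abs x (ht h), kinkIntegrand_eq_abs y (ht h),
      Real.coe_nnabs, abs_of_nonneg hC0]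
    exact (abs_abs_sub_abs_le _ _).trans (hlip y x hy hx)
  · have hne : ∀ᵐ t ∂(volume : Measure ℝ), t ≠ L / (L + 1) * ρ := by simp [ae_iff]
    filter_upwards [hIoo, hne] with t ht hta h
    have hW := one_sub_sq_pos_of_mem (ht h)
    have hD := distance_pos hρ.le hρ1 (ht h).2.le
    have hpos : 0 < (1 - t ^ 2) ^ (L - 1 / 2) * (1 - 2 * t * ρ + ρ ^ 2) ^ (-L) := by positivity
    have e := (hasDerivAt_abs (mul_ne_zero (sub_ne_zero.2 hta) hpos.ne')).comp ρ
      (hasDerivAt_signed_integrand L hD)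
    rw [sign_mul, sign_pos hpos, mul_one] at e
    exact e.congr_of_eventuallyEq (Eventually.of_forall fun x => kinkIntegrand_eq_abs x (ht h))

/-! ### Monotonicity, the value at `0`, and the conclusion -/

lemma strictAntiOn_integral_kinkIntegrand {L : ℝ} (hL : 1 ≤ L) :
    StrictAntiOn (fun ρ => ∫ t in (-1 : ℝ)..1, kinkIntegrand L ρ t) (Icc 0 1) := by
  refine strictAntiOn_of_deriv_neg (convex_Icc 0 1) (continuousOn_integral_kinkIntegrand hL)
    fun ρ hρ => ?_
  rw [interior_Icc] at hρ
  rw [(hasDerivAt_integral_kinkIntegrand hL hρ.1 hρ.2).deriv,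
    integral_sign_mul_derivKernel hL hρ.1 hρ.2]
  linarith [derivKernelPrimitive_kink_pos hL hρ.1 hρ.2]

lemma integral_kinkIntegrand_zero {L : ℝ} (hL : 1 ≤ L) :
    ∫ t in (-1 : ℝ)..1, kinkIntegrand L 0 t = 2 / (2 * L + 1) := by
  have hderiv (t : ℝ) : HasDerivAt (fun s : ℝ => -(1 - s ^ 2) ^ (L + 1 / 2) / (2 * L + 1))
      (t * (1 - t ^ 2) ^ (L - 1 / 2)) t := by
    have dW : HasDerivAt (fun s : ℝ => 1 - s ^ 2) (-(2 * t)) t := by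
      simpa using (hasDerivAt_pow 2 t).const_sub 1
    -- As `L + 1/2 ≥ 1`, the power rule holds even where the base vanishes, so `t` needs no
    -- restriction.
    refine ((dW.rpow_const (p := L + 1 / 2) (Or.inr (by linarith))).neg.div_const
      (2 * L + 1)).congr_deriv ?_
    have : 2 * L + 1 ≠ 0 := by positivity
    rw [show L + 1 / 2 - 1 = L - 1 / 2 by ring]
    field_simp
  have hint (a b : ℝ) :
      IntervalIntegrable (fun t : ℝ => t * (1 - t ^ 2) ^ (L - 1 / 2)) volume a b := by
    refine (continuous_id.mul (Continuous.rpow_const (by fun_prop) fun t => ?_)).intervalIntegrable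
      a b
    exact Or.inr (by linarith)
  have hval (a b : ℝ) := intervalIntegral.integral_eq_sub_of_hasDerivAt
    (fun t _ => hderiv t) (hint a b)
  have hI := intervalIntegrable_kinkIntegrand hL (left_mem_Icc.2 (zero_le_one (α := ℝ)))
  rw [← intervalIntegral.integral_add_adjacent_intervals (b := 0)
    (hI.mono_set (by rw [uIcc_of_le (by norm_num), uIcc_of_le (by norm_num)]
                     exact Icc_subset_Icc_right zero_le_one))
    (hI.mono_set (by rw [uIcc_of_le (by norm_num), uIcc_of_le (by norm_num)]
                     exact Icc_subset_Icc_left (by norm_num)))]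
  have hl : ∫ t in (-1 : ℝ)..0, kinkIntegrand L 0 t
      = ∫ t in (-1 : ℝ)..0, -(t * (1 - t ^ 2) ^ (L - 1 / 2)) := by
    refine intervalIntegral.integral_congr fun t ht => ?_
    rw [uIcc_of_le (by norm_num)] at ht
    simp [kinkIntegrand, abs_of_nonpos ht.2]
  have hr : ∫ t in (0 : ℝ)..1, kinkIntegrand L 0 t
      = ∫ t in (0 : ℝ)..1, t * (1 - t ^ 2) ^ (L - 1 / 2) := by
    refine intervalIntegral.integral_congr fun t ht => ?_
    rw [uIcc_of_le zero_le_one] at ht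
    simp [kinkIntegrand, abs_of_nonneg ht.1]
  rw [hl, hr, intervalIntegral.integral_neg, hval, hval]
  have h0 : (0 : ℝ) ^ (L + 1 / 2) = 0 := Real.zero_rpow (by positivity)
  norm_num at h0 ⊢
  rw [h0]
  ring

lemma schwarzIntegrand_eq_kinkIntegrand {n : ℕ} (hn : 4 ≤ n) (ρ : ℝ) :
    schwarzIntegrand n ρ = kinkIntegrand (((n : ℝ) - 2) / 2) ρ := by
  have hn' : (4 : ℝ) ≤ n := by exact_mod_cast hn
  have hc : ((n : ℝ) - 2) / 2 / (((n : ℝ) - 2) / 2 + 1) = ((n : ℝ) - 2) / n := by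
    have : (n : ℝ) - 2 + 2 ≠ 0 := by linarith
    field_simp
    ring
  ext t
  unfold schwarzIntegrand kinkIntegrand
  rw [hc, show ((n : ℝ) - 2) / 2 - 1 / 2 = ((n : ℝ) - 3) / 2 by ring]

theorem mainTheorem2 (n : ℕ) (hn : 4 ≤ n) :
    (∀ ρ ∈ Set.Icc (0 : ℝ) 1,
      IntervalIntegrable (schwarzIntegrand n ρ) MeasureTheory.volume (-1) 1) ∧
    StrictAntiOn (schwarzPhi n) (Set.Icc (0 : ℝ) 1) ∧
    IsGreatest (schwarzPhi n '' Set.Icc (0 : ℝ) 1) (schwarzPhi n 0) ∧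
    schwarzPhi n 0 = 2 / ((n : ℝ) - 1) := by
  have hn' : (4 : ℝ) ≤ n := by exact_mod_cast hn
  have hL : 1 ≤ ((n : ℝ) - 2) / 2 := by linarith
  have hPhi : schwarzPhi n
      = fun ρ => ∫ t in (-1 : ℝ)..1, kinkIntegrand (((n : ℝ) - 2) / 2) ρ t := by
    ext ρ
    rw [schwarzPhi, schwarzIntegrand_eq_kinkIntegrand hn]
  have hanti : StrictAntiOn (schwarzPhi n) (Icc (0 : ℝ) 1) :=
    hPhi ▸ strictAntiOn_integral_kinkIntegrand hL
  have h0 : (0 : ℝ) ∈ Icc (0 : ℝ) 1 := left_mem_Icc.2 zero_le_one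
  refine ⟨fun ρ hρ => ?_, hanti, ⟨mem_image_of_mem _ h0, ?_⟩, ?_⟩
  · rw [schwarzIntegrand_eq_kinkIntegrand hn]
    exact intervalIntegrable_kinkIntegrand hL hρ
  · rintro _ ⟨ρ, hρ, rfl⟩
    exact hanti.antitoneOn h0 hρ hρ.1
  · rw [hPhi]
    refine (integral_kinkIntegrand_zero hL).trans ?_
    congr 1
    ring
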